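/- Let $n\ge 2$ and let $\mathcal P_n$ be the space of complex polynomials of degree at most $n$, $D$ the differentiation operator on it, and $T=I+\alpha_2D^2+\cdots+\alpha_nD^n$ with $\alpha_2,\dots,\alpha_n\in\mathbb C$. For a non-constant polynomial $f$ let $Z(f)\subset\mathbb C$ be its set of roots, and put $$R_T(f)=\inf\{r>0:\ Z(Tf)\subset Z(f)+\{|z|\le r\}\},\qquad \tau(f)=\min\{|w-v|:\ w\in Z(f),\ v\in Z(f')\setminus\{w\}\}.$$ Since $\deg Tf=\deg f=m$, we can list the roots of $f$ and of $Tf$ with multiplicity as $z_1,\dots,z_m$ and $w_1,\dots,w_m$; the Fréchet distance is $d_F(Z(f),Z(Tf))=\min_\sigma\max_k|z_k-w_{\sigma(k)}|$, the minimum being over all permutations $\sigma$ of $\{1,\dots,m\}$. With $\phi_n(z)=z^n$ and $R=R_T(\phi_n)$, set $$\Gamma'_T=n\Bigl(\max_{2\le k\le n}|\alpha_k|\,(k-1)!\Bigr)(R+1)\left(\Bigl(\frac{R+2}{R+1}\Bigr)^{n-1}-1\right),\qquad \Gamma_T=\max\{R(2R+1),\,2\Gamma'_T\}.$$ Then there is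 a smallest constant $K_F(T)$ such that $d_F(Z(f),Z(Tf))\le K_F(T)$ for all non-constant $f\in\mathcal P_n$, and for every non-constant $f\in\mathcal P_n$ with simple roots $$\tau(f)\,d_F\bigl(Z(f),Z(Tf)\bigr)\le\max\left\{\Gamma_T,\ K_F(T)\,\Gamma_T,\ K_F(T)\,\frac{1+K_F(T)}{\sin(\pi/n)}\right\}.$$ (For $\deg f=1$, where no $v$ as in the definition of $\tau(f)$ exists, $Tf=f$ and the left side is read as $0$.) -/

import Mathlib

open Polynomial
open scoped Pointwise Nat

noncomputable section

namespace RootPerturbation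

/-- The space of complex polynomials of degree at most `n`. -/
abbrev PolySpace (n : ℕ) : Type := degreeLE ℂ (n : WithBot ℕ)

theorem derivative_mem (n : ℕ) (p : ℂ[X]) (hp : p ∈ degreeLE ℂ (n : WithBot ℕ)) :
    derivative p ∈ degreeLE ℂ (n : WithBot ℕ) :=
  mem_degreeLE.2 ((degree_derivative_le (p := p)).trans (mem_degreeLE.1 hp))

/-- The differentiation operator on polynomials of degree at most `n`. -/
def diffOp (n : ℕ) : Module.End ℂ (PolySpace n) :=
  (derivative (R := ℂ)).restrict (derivative_mem n)

/-- The operator `I + α₂ D² + ⋯ + αₙ Dⁿ` on polynomials of degree at most `n`. -/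
def opT (n : ℕ) (α : ℕ → ℂ) : Module.End ℂ (PolySpace n) :=
  1 + ∑ k ∈ Finset.Icc 2 n, α k • diffOp n ^ k

/-- The monomial `z ↦ zⁿ`. -/
def monomialTop (n : ℕ) : PolySpace n :=
  ⟨X ^ n, mem_degreeLE.2 (degree_X_pow_le n)⟩

/-- The set of roots. -/
def rootsOf (f : ℂ[X]) : Set ℂ := {w | f.eval w = 0}

/-- `R_T(f)`: the least `r` such that every root of `T f` is within `r` of a root of `f`. The
infimum is used so that the value is `0` when every root of `T f` is a root of `f`. -/
def maxShift {n : ℕ} (T : Module.End ℂ (PolySpace n)) (f : PolySpace n) : ℝ :=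
  sInf {r : ℝ | 0 < r ∧
    rootsOf (T f : ℂ[X]) ⊆ rootsOf (f : ℂ[X]) + Metric.closedBall (0 : ℂ) r}

/-- `τ(f)`: the least distance from a root `w` of `f` to a root of `f'` different from `w`. -/
def tau (f : ℂ[X]) : ℝ :=
  sInf {d : ℝ | ∃ w ∈ rootsOf f, ∃ v ∈ rootsOf (derivative f) \ {w}, d = ‖w - v‖}

/-- The Fréchet distance of two families of `m` complex numbers. The minimum over permutations
and the maximum over indices are taken over finite types. -/
def frechetDist {m : ℕ} (u v : Fin m → ℂ) : ℝ :=
  ⨅ σ : Equiv.Perm (Fin m), ⨆ k : Fin m, ‖u k - v (σ k)‖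

theorem frechetDist_comp {m : ℕ} (u v : Fin m → ℂ) (π ρ : Equiv.Perm (Fin m)) :
    frechetDist (u ∘ π) (v ∘ ρ) = frechetDist u v := by
  unfold frechetDist
  refine Equiv.iInf_congr (((Equiv.mulLeft ρ)).trans (Equiv.mulRight π⁻¹)) fun σ => ?_
  refine Equiv.iSup_congr π.symm fun k => ?_
  simp

/-- The Fréchet distance of two multisets of the same size: the distance of any two enumerations
of them, see `multisetDist_eq`. -/
def multisetDist (A B : Multiset ℂ) : ℝ :=
  sInf {d : ℝ | ∃ (m : ℕ) (u v : Fin m → ℂ), Finset.univ.val.map u = A ∧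
    Finset.univ.val.map v = B ∧ d = frechetDist u v}

theorem exists_perm_of_map_eq {m : ℕ} {u u' : Fin m → ℂ}
    (h : Finset.univ.val.map u = Finset.univ.val.map u') :
    ∃ π : Equiv.Perm (Fin m), u' = u ∘ π := by
  have hc : ∀ c, Fintype.card {i // u' i = c} = Fintype.card {i // u i = c} := by
    intro c
    have := congrArg (Multiset.count c) h
    rw [Multiset.count_map, Multiset.count_map] at this
    rw [Fintype.card_subtype, Fintype.card_subtype]
    simp only [Finset.card, Finset.filter_val, eq_comm (b := c)]
    exact this.symm
  refine ⟨Equiv.ofFiberEquiv fun c => Fintype.equivOfCardEq (hc c), ?_⟩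
  funext i
  exact (Equiv.ofFiberEquiv_map _ i).symm

theorem multisetDist_eq {m : ℕ} (u v : Fin m → ℂ) :
    multisetDist (Finset.univ.val.map u) (Finset.univ.val.map v) = frechetDist u v := by
  have : {d : ℝ | ∃ (m' : ℕ) (u' v' : Fin m' → ℂ),
      Finset.univ.val.map u' = Finset.univ.val.map u ∧
      Finset.univ.val.map v' = Finset.univ.val.map v ∧ d = frechetDist u' v'} =
      {frechetDist u v} := by
    ext d
    constructor
    · rintro ⟨m', u', v', hu, hv, rfl⟩
      have hm : m' = m := by simpa using congrArg Multiset.card hu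
      subst hm
      obtain ⟨π, rfl⟩ := exists_perm_of_map_eq hu.symm
      obtain ⟨ρ, rfl⟩ := exists_perm_of_map_eq hv.symm
      exact frechetDist_comp u v π ρ
    · rintro rfl
      exact ⟨m, u, v, rfl, rfl, rfl⟩
  unfold multisetDist
  rw [this, csInf_singleton]

/-- `d_F(Z(f), Z(T f))`, with roots counted with multiplicity. -/
def rootDist {n : ℕ} (T : Module.End ℂ (PolySpace n)) (f : PolySpace n) : ℝ :=
  multisetDist (f : ℂ[X]).roots (T f : ℂ[X]).roots

theorem coe_diffOp_pow (n k : ℕ) (f : PolySpace n) :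
    (((diffOp n ^ k) f : PolySpace n) : ℂ[X]) = derivative^[k] (f : ℂ[X]) := by
  induction k with
  | zero => simp
  | succ k ih =>
    rw [pow_succ', Function.iterate_succ_apply', ← ih]
    rfl

theorem coe_opT (n : ℕ) (α : ℕ → ℂ) (f : PolySpace n) :
    (opT n α f : ℂ[X]) =
      (f : ℂ[X]) + ∑ k ∈ Finset.Icc 2 n, α k • derivative^[k] (f : ℂ[X]) := by
  simp [opT, LinearMap.add_apply, LinearMap.sum_apply, coe_diffOp_pow]

/-- The operator preserves the degree, so the two multisets of roots below have the same size. -/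
theorem card_roots_opT (n : ℕ) (α : ℕ → ℂ) (f : PolySpace n) :
    Multiset.card (opT n α f : ℂ[X]).roots = Multiset.card (f : ℂ[X]).roots := by
  rw [IsAlgClosed.card_roots_eq_natDegree, IsAlgClosed.card_roots_eq_natDegree, coe_opT]
  by_cases h0 : (f : ℂ[X]).natDegree = 0
  · rw [Finset.sum_eq_zero, add_zero]
    intro k hk
    have hk2 := (Finset.mem_Icc.1 hk).1
    rw [iterate_derivative_eq_zero (by omega), smul_zero]
  · apply natDegree_add_eq_left_of_natDegree_lt
    refine lt_of_le_of_lt (natDegree_sum_le_of_forall_le (n := (f : ℂ[X]).natDegree - 1) _ _ ?_)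
      (by omega)
    intro k hk
    have hk2 := (Finset.mem_Icc.1 hk).1
    refine (natDegree_smul_le _ _).trans ((natDegree_iterate_derivative _ _).trans ?_)
    omega

/-- The constants `C` such that `d_F(Z(f), Z(T f)) ≤ C` for all non-constant `f`. -/
def frechetBounds {n : ℕ} (T : Module.End ℂ (PolySpace n)) : Set ℝ :=
  {C : ℝ | ∀ f : PolySpace n, 0 < (f : ℂ[X]).natDegree → rootDist T f ≤ C}

/-- `K_F(T)`: the least constant `C` such that `d_F(Z(f), Z(T f)) ≤ C` for all non-constant
`f`. -/
def KF {n : ℕ} (T : Module.End ℂ (PolySpace n)) : ℝ := sInf (frechetBounds T)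

/-- The constant `Γ'_T` for `T = I + α₂ D² + ⋯ + αₙ Dⁿ`. -/
def GammaAux (n : ℕ) (α : ℕ → ℂ) : ℝ :=
  n * (⨆ k : Finset.Icc 2 n, ‖α k‖ * ((k : ℕ) - 1)!) *
    (maxShift (opT n α) (monomialTop n) + 1) *
    (((maxShift (opT n α) (monomialTop n) + 2) /
      (maxShift (opT n α) (monomialTop n) + 1)) ^ (n - 1) - 1)

/-- The constant `Γ_T` for `T = I + α₂ D² + ⋯ + αₙ Dⁿ`. -/
def Gamma (n : ℕ) (α : ℕ → ℂ) : ℝ :=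
  max (maxShift (opT n α) (monomialTop n) * (2 * maxShift (opT n α) (monomialTop n) + 1))
    (2 * GammaAux n α)

end RootPerturbation

end

/-! Write $K=K_F(T)$. If $\tau(f)\le\Gamma_T$ or $\tau(f)\le(1+K)/\sin(\pi/n)$, the bound $d_F\le K$
already suffices. Otherwise the roots of $f$ are so far apart, and those of $Tf$ so close to them,
that an optimal matching, which moves no root by more than $K$, must pair each root of $Tf$ with the
root of $f$ near it.

Closeness: Grace's theorem for the functional $g\mapsto(Tg)(v)$ reduces the location of the roots of
$Tf$ to the case of powers, so each root $v$ of $Tf$ is within $R$ of $Z(f)$. When $\tau(f)\ge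
2R+1$, $v$ is at least $\tau(f)-R$ away from all critical points. There the higher derivatives are
controlled by $f'(v)$, so $Tf(v)=0$ forces $|f(v)|$ to be of order $|f'(v)|/\tau(f)$, and $\deg
f\cdot|f(v)/f'(v)|$ bounds the distance to the nearest root.

Separation: Grace's theorem for the functional $h'\mapsto h(w_2)-h(w_1)$ yields a critical point
near any two roots (Grace–Heawood), so distinct roots are at least $\tau(f)\sin(\pi/n)$ apart.

Finiteness of $K$: on the segment from $f$ to $Tf$ the roots stay within a fixed distance of $Z(f)$,
and by connectedness no root mass passes between clusters of the corresponding discs. -/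

namespace RootPerturbation

/-! ### Derivatives at a point away from the roots -/

/-- If all points of `s` are at distance at least `d` from `w`, then the Taylor coefficients at `w`
of the polynomial with root multiset `s` are controlled by its value at `w`. -/
theorem norm_taylor_coeff_prod_le (s : Multiset ℂ) (w : ℂ) {d : ℝ} (hd : 0 ≤ d)
    (h : ∀ z ∈ s, d ≤ ‖w - z‖) (k : ℕ) :
    ‖(taylor w (s.map fun a => X - C a).prod).coeff k‖ * d ^ k ≤
      (Multiset.card s).choose k * ‖(s.map fun a => X - C a).prod.eval w‖ := by
  induction s using Multiset.induction generalizing k with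
  | empty => cases k <;> simp [coeff_one]
  | cons a s ih =>
    have hs : ∀ z ∈ s, d ≤ ‖w - z‖ := fun z hz => h z (Multiset.mem_cons_of_mem hz)
    have ha : d ≤ ‖w - a‖ := h a (Multiset.mem_cons_self a s)
    set p := (s.map fun a => X - C a).prod with hp
    have htay : taylor w (((a ::ₘ s).map fun a => X - C a).prod) =
        X * taylor w p + C (w - a) * taylor w p := by
      simp only [Multiset.map_cons, Multiset.prod_cons, taylor_mul, ← hp, map_sub, taylor_X,
        taylor_C]
      ring
    have hev : (((a ::ₘ s).map fun a => X - C a).prod).eval w = (w - a) * p.eval w := by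
      simp [hp]
    rw [htay, hev, Multiset.card_cons]
    cases k with
    | zero => simp [taylor_coeff_zero]
    | succ k =>
      -- The factor $X-a$ mixes the coefficients of index $k$ and $k+1$. Replacing one factor $d$ by
      -- $\|w-a\|$ in the first term lets both share the factor of the new value at $w$, and the
      -- binomials add by Pascal's rule.
      rw [coeff_add, coeff_X_mul, coeff_C_mul, norm_mul, Nat.choose_succ_succ, Nat.cast_add]
      have h1 := ih hs k
      have h2 := ih hs (k + 1)
      have h3 : ‖(taylor w p).coeff k + (w - a) * (taylor w p).coeff (k + 1)‖ ≤
          ‖(taylor w p).coeff k‖ + ‖w - a‖ * ‖(taylor w p).coeff (k + 1)‖ := by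
        rw [← norm_mul]; exact norm_add_le _ _
      have h4 : 0 ≤ ((Multiset.card s).choose k : ℝ) * ‖p.eval w‖ := by positivity
      calc _ ≤ (‖(taylor w p).coeff k‖ + ‖w - a‖ * ‖(taylor w p).coeff (k + 1)‖) * d ^ (k + 1) := by
            gcongr
        _ = d * (‖(taylor w p).coeff k‖ * d ^ k) +
            ‖w - a‖ * (‖(taylor w p).coeff (k + 1)‖ * d ^ (k + 1)) := by ring
        _ ≤ ‖w - a‖ * ((Multiset.card s).choose k * ‖p.eval w‖) +
            ‖w - a‖ * ((Multiset.card s).choose (k + 1) * ‖p.eval w‖) := by gcongr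
        _ = _ := by ring

theorem eval_iterate_derivative_eq (p : ℂ[X]) (k : ℕ) (w : ℂ) :
    (derivative^[k] p).eval w = k ! * (taylor w p).coeff k := by
  rw [taylor_coeff, ← factorial_smul_hasseDeriv]
  simp

/-- A bound for the derivatives of a polynomial at a point away from its roots. -/
theorem norm_iterate_derivative_eval_le (p : ℂ[X]) (w : ℂ) {d : ℝ} (hd : 0 ≤ d)
    (h : ∀ z, p.IsRoot z → d ≤ ‖w - z‖) (k : ℕ) :
    ‖(derivative^[k] p).eval w‖ * d ^ k ≤ k ! * (p.natDegree.choose k * ‖p.eval w‖) := by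
  have hs : ∀ z ∈ p.roots, d ≤ ‖w - z‖ := fun z hz => h z (isRoot_of_mem_roots hz)
  have h1 := norm_taylor_coeff_prod_le p.roots w hd hs k
  rw [IsAlgClosed.card_roots_eq_natDegree] at h1
  have h2 := (IsAlgClosed.splits p).eq_prod_roots
  set q := (p.roots.map fun a => X - C a).prod
  have h3 : (taylor w p).coeff k = p.leadingCoeff * (taylor w q).coeff k := by
    conv_lhs => rw [h2]
    rw [taylor_mul, taylor_C, coeff_C_mul]
  have h4 : p.eval w = p.leadingCoeff * q.eval w := by
    conv_lhs => rw [h2]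
    simp
  rw [eval_iterate_derivative_eq, h3, h4, norm_mul, norm_mul, norm_mul, Complex.norm_natCast]
  calc _ = k ! * (‖p.leadingCoeff‖ * (‖(taylor w q).coeff k‖ * d ^ k)) := by ring
    _ ≤ k ! * (‖p.leadingCoeff‖ * (p.natDegree.choose k * ‖q.eval w‖)) := by gcongr
    _ = _ := by ring

/-! ### Inversion of discs and Laguerre's lemma -/

theorem norm_multiset_sum_sub_le (s : Multiset ℂ) (c : ℂ) {ρ : ℝ} (h : ∀ x ∈ s, ‖x - c‖ ≤ ρ) :
    ‖s.sum - Multiset.card s * c‖ ≤ Multiset.card s * ρ := by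
  induction s using Multiset.induction with
  | empty => simp
  | cons a s ih =>
    have h1 := ih fun x hx => h x (Multiset.mem_cons_of_mem hx)
    have h2 := h a (Multiset.mem_cons_self a s)
    rw [Multiset.sum_cons, Multiset.card_cons]
    calc _ = ‖(a - c) + (s.sum - Multiset.card s * c)‖ := by congr 1; push_cast; ring
      _ ≤ ‖a - c‖ + ‖s.sum - Multiset.card s * c‖ := norm_add_le _ _
      _ ≤ ρ + Multiset.card s * ρ := add_le_add h2 h1
      _ = _ := by push_cast; ring

/-- Inversion maps a disc not containing the origin to a disc. -/
theorem norm_sub_le_iff_inv {a u : ℂ} {r : ℝ} (hr : 0 ≤ r) (ha : r < ‖a‖) (hu : u ≠ 0) :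
    ‖a - u‖ ≤ r ↔
      ‖u⁻¹ - (starRingEnd ℂ) a / ((‖a‖ ^ 2 - r ^ 2 : ℝ) : ℂ)‖ ≤ r / (‖a‖ ^ 2 - r ^ 2) := by
  have hpos : 0 < ‖a‖ ^ 2 - r ^ 2 := by nlinarith
  set D : ℝ := ‖a‖ ^ 2 - r ^ 2 with hD
  have hDc : (D : ℂ) ≠ 0 := by exact_mod_cast hpos.ne'
  have hu' : 0 < ‖u‖ := norm_pos_iff.2 hu
  have e1 : u⁻¹ - (starRingEnd ℂ) a / (D : ℂ) = (D - u * (starRingEnd ℂ) a) / (u * D) := by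
    field_simp
  have hDn : ‖(D : ℂ)‖ = D := by rw [Complex.norm_real, Real.norm_of_nonneg hpos.le]
  rw [e1, norm_div, norm_mul, hDn, div_le_div_iff₀ (by positivity) hpos]
  have e2 : ‖(D : ℂ) - u * (starRingEnd ℂ) a‖ * D ≤ r * (‖u‖ * D) ↔
      ‖(D : ℂ) - u * (starRingEnd ℂ) a‖ ≤ r * ‖u‖ := by
    rw [← mul_assoc]; exact mul_le_mul_iff_left₀ hpos
  rw [e2, ← sq_le_sq₀ (norm_nonneg _) hr, ← sq_le_sq₀ (norm_nonneg _) (by positivity)]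
  have e3 : ‖a - u‖ ^ 2 = ‖a‖ ^ 2 + ‖u‖ ^ 2 - 2 * (a.re * u.re + a.im * u.im) := by
    simp only [← Complex.normSq_eq_norm_sq, Complex.normSq_apply, Complex.sub_re, Complex.sub_im]
    ring
  have e4 : ‖(D : ℂ) - u * (starRingEnd ℂ) a‖ ^ 2 =
      D ^ 2 - 2 * D * (a.re * u.re + a.im * u.im) + ‖u‖ ^ 2 * ‖a‖ ^ 2 := by
    simp only [← Complex.normSq_eq_norm_sq, Complex.normSq_apply, Complex.sub_re, Complex.sub_im,
      Complex.mul_re, Complex.mul_im, Complex.conj_re, Complex.conj_im, Complex.ofReal_re,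
      Complex.ofReal_im]
    ring
  rw [e3, e4]
  -- After squaring, the two inequalities differ exactly by the positive factor $D$.
  have e5 : D ^ 2 - 2 * D * (a.re * u.re + a.im * u.im) + ‖u‖ ^ 2 * ‖a‖ ^ 2 - (r * ‖u‖) ^ 2 =
      D * (‖a‖ ^ 2 + ‖u‖ ^ 2 - 2 * (a.re * u.re + a.im * u.im) - r ^ 2) := by
    rw [hD]; ring
  constructor
  · intro h
    nlinarith [mul_nonneg hpos.le (sub_nonneg.2 h)]
  · intro h
    have : D * (‖a‖ ^ 2 + ‖u‖ ^ 2 - 2 * (a.re * u.re + a.im * u.im) - r ^ 2) ≤ 0 := by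
      linarith
    by_contra hcon
    have := mul_pos hpos (sub_pos.2 (not_le.1 hcon))
    linarith

/-- Laguerre's lemma: if the roots `q` lie in a disc and `ζ` does not, then the point `v` whose
reciprocal distance vector to `ζ` is the mean of those of the roots lies in the disc. -/
theorem norm_sub_le_of_sum_inv_eq {s : Multiset ℂ} {c ζ v : ℂ} {r : ℝ} (hr : 0 ≤ r)
    (hs : ∀ q ∈ s, ‖q - c‖ ≤ r) (hcard : 0 < Multiset.card s) (hζ : r < ‖ζ - c‖) (hv : ζ ≠ v)
    (hsum : (s.map fun q => 1 / (ζ - q)).sum = Multiset.card s * (1 / (ζ - v))) :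
    ‖v - c‖ ≤ r := by
  have hv' : ζ - v ≠ 0 := sub_ne_zero.2 hv
  have e : ∀ q : ℂ, q - c = (ζ - c) - (ζ - q) := fun q => by ring
  rw [e v, norm_sub_le_iff_inv hr hζ hv']
  set c' := (starRingEnd ℂ) (ζ - c) / ((‖ζ - c‖ ^ 2 - r ^ 2 : ℝ) : ℂ)
  set ρ := r / (‖ζ - c‖ ^ 2 - r ^ 2)
  -- Inversion about $\zeta$ carries the disc to a disc, which by convexity contains the mean of the
  -- points $1/(\zeta-q)$.
  have h := norm_multiset_sum_sub_le (s.map fun q => 1 / (ζ - q)) c' (ρ := ρ) (by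
    intro x hx
    obtain ⟨q, hq, rfl⟩ := Multiset.mem_map.1 hx
    have hq' := hs q hq
    have hne : ζ - q ≠ 0 := by
      intro h0
      rw [← sub_eq_zero.1 h0] at hq'
      linarith
    rw [e q, norm_sub_le_iff_inv hr hζ hne] at hq'
    rwa [one_div])
  rw [hsum, Multiset.card_map, ← mul_sub, norm_mul, Complex.norm_natCast, one_div] at h
  exact le_of_mul_le_mul_left h (by exact_mod_cast hcard)

/-! ### Grace's theorem -/

/-- The polynomial `ζ ↦ L ((X - ζ) ^ k)` attached to a linear functional `L`. -/
noncomputable def shiftPoly (L : ℂ[X] →ₗ[ℂ] ℂ) (k : ℕ) : ℂ[X] :=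
  ∑ j ∈ Finset.range (k + 1), C ((-1) ^ (k - j) * k.choose j * L (X ^ j)) * X ^ (k - j)

theorem eval_shiftPoly (L : ℂ[X] →ₗ[ℂ] ℂ) (k : ℕ) (ζ : ℂ) :
    (shiftPoly L k).eval ζ = L ((X - C ζ) ^ k) := by
  rw [sub_eq_add_neg, add_pow, map_sum, shiftPoly, eval_finsetSum]
  refine Finset.sum_congr rfl fun j _ => ?_
  have : (X : ℂ[X]) ^ j * (-C ζ) ^ (k - j) * (k.choose j : ℂ[X]) =
      ((-1) ^ (k - j) * ζ ^ (k - j) * (k.choose j : ℂ)) • X ^ j := by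
    rw [smul_eq_C_mul, neg_pow]
    simp only [map_mul, map_pow, map_neg, map_one, map_natCast]
    ring
  rw [this, map_smul]
  simp
  ring

/-- Differentiation in $\zeta$ lowers the power, so the logarithmic derivative of `shiftPoly L (k +
1)` compares $L$ on two consecutive powers. -/
theorem derivative_shiftPoly (L : ℂ[X] →ₗ[ℂ] ℂ) (k : ℕ) :
    derivative (shiftPoly L (k + 1)) = C (-((k : ℂ) + 1)) * shiftPoly L k := by
  rw [shiftPoly, Finset.sum_range_succ, derivative_add, derivative_sum, shiftPoly, Finset.mul_sum]
  have : derivative (C ((-1) ^ (k + 1 - (k + 1)) * ((k + 1).choose (k + 1) : ℂ) *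
      L (X ^ (k + 1))) * X ^ (k + 1 - (k + 1))) = 0 := by
    simp [derivative_C]
  rw [this, add_zero]
  refine Finset.sum_congr rfl fun j hj => ?_
  have hj' : j ≤ k := Nat.lt_succ_iff.1 (Finset.mem_range.1 hj)
  have hsub : k + 1 - j = (k - j) + 1 := by omega
  have hch := Nat.choose_mul_succ_eq k j
  rw [hsub] at hch ⊢
  have hch' : (k.choose j : ℂ) * (k + 1) = ((k + 1).choose j : ℂ) * ((k - j : ℕ) + 1) := by
    exact_mod_cast hch
  rw [derivative_C_mul_X_pow, ← mul_assoc, ← C_mul, Nat.add_sub_cancel]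
  congr 2
  push_cast
  linear_combination (-1) ^ (k - j) * L (X ^ j) * hch'

theorem natDegree_shiftPoly (L : ℂ[X] →ₗ[ℂ] ℂ) (hL : L 1 ≠ 0) (k : ℕ) :
    (shiftPoly L k).natDegree = k := by
  apply natDegree_eq_of_le_of_coeff_ne_zero
  · refine natDegree_sum_le_of_forall_le _ _ fun j _ => ?_
    exact (natDegree_C_mul_X_pow_le _ _).trans (Nat.sub_le _ _)
  · rw [shiftPoly, finsetSum_coeff, Finset.sum_eq_single 0]
    · rw [coeff_C_mul_X_pow]
      simpa using hL
    · intro j hj hj0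
      rw [coeff_C_mul_X_pow, if_neg]
      have := Finset.mem_range.1 hj
      omega
    · simp

/-- One step in the proof of Grace's theorem. -/
theorem map_X_sub_C_mul_pow_ne_zero (L : ℂ[X] →ₗ[ℂ] ℂ) (hL : L 1 ≠ 0) {c v : ℂ} {r : ℝ}
    (hr : 0 ≤ r) (k : ℕ) (h : ∀ ζ, r < ‖ζ - c‖ → L ((X - C ζ) ^ (k + 1)) ≠ 0)
    (hv : r < ‖v - c‖) {ζ : ℂ} (hζ : r < ‖ζ - c‖) : L ((X - C v) * (X - C ζ) ^ k) ≠ 0 := by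
  intro h0
  -- With $p$ the polynomial `shiftPoly L (k + 1)`, vanishing would read
  -- $p'(\zeta)/p(\zeta)=(k+1)/(\zeta-v)$. Since all roots of $p$ lie in the disc, Laguerre's lemma
  -- would put $v$ there too.
  have e1 : (X - C v) * (X - C ζ) ^ k = (X - C ζ) ^ (k + 1) + (ζ - v) • (X - C ζ) ^ k := by
    rw [smul_eq_C_mul, C_sub]; ring
  rw [e1, map_add, map_smul, smul_eq_mul, ← eval_shiftPoly, ← eval_shiftPoly] at h0
  have hne : (shiftPoly L (k + 1)).eval ζ ≠ 0 := by rw [eval_shiftPoly]; exact h ζ hζ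
  have hζv : ζ ≠ v := by
    rintro rfl
    simp only [sub_self, zero_mul, add_zero] at h0
    exact hne h0
  have hsum := (IsAlgClosed.splits (shiftPoly L (k + 1))).eval_derivative_div_eval_of_ne_zero hne
  have hcard : Multiset.card (shiftPoly L (k + 1)).roots = k + 1 := by
    rw [IsAlgClosed.card_roots_eq_natDegree, natDegree_shiftPoly L hL]
  refine absurd (norm_sub_le_of_sum_inv_eq (s := (shiftPoly L (k + 1)).roots) (ζ := ζ) hr ?_
    (by omega) hζ hζv ?_) (not_le.2 hv)
  · intro q hq
    by_contra hq'
    exact h q (not_le.1 hq') (by rw [← eval_shiftPoly]; exact isRoot_of_mem_roots hq)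
  · rw [← hsum, hcard, derivative_shiftPoly, eval_mul, eval_C]
    have : ζ - v ≠ 0 := sub_ne_zero.2 hζv
    field_simp
    push_cast
    linear_combination (-(k : ℂ) - 1) * h0

/-- Grace's theorem for the exterior of a disc: if a linear functional does not vanish at the
powers `(X - ζ) ^ k` with `ζ` outside the disc, then it does not vanish at products of linear
factors whose roots are outside the disc. -/
theorem map_prod_X_sub_C_ne_zero {c : ℂ} {r : ℝ} (hr : 0 ≤ r) (s : Multiset ℂ)
    (hs : ∀ v ∈ s, r < ‖v - c‖) (L : ℂ[X] →ₗ[ℂ] ℂ)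
    (h : ∀ k ≤ Multiset.card s, ∀ ζ, r < ‖ζ - c‖ → L ((X - C ζ) ^ k) ≠ 0) :
    L (s.map fun v => X - C v).prod ≠ 0 := by
  have hout : r < ‖(c + ((r + 1 : ℝ) : ℂ)) - c‖ := by
    rw [add_sub_cancel_left, Complex.norm_real, Real.norm_of_nonneg (by linarith)]
    linarith
  induction s using Multiset.induction generalizing L with
  | empty => simpa using h 0 le_rfl _ hout
  | cons a s ih =>
    have ha := hs a (Multiset.mem_cons_self a s)
    -- The factor $X-a$ is absorbed into the functional, which by the one-step lemma still satisfies
    -- the hypothesis on powers, up to one degree less.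
    have := ih (fun v hv => hs v (Multiset.mem_cons_of_mem hv))
      (L ∘ₗ LinearMap.mulLeft ℂ (X - C a)) (by
        intro k hk ζ hζ
        rw [LinearMap.comp_apply, LinearMap.mulLeft_apply]
        refine map_X_sub_C_mul_pow_ne_zero L ?_ hr k (h (k + 1) ?_) ha hζ
        · simpa using h 0 (Nat.zero_le _) _ hout
        · rw [Multiset.card_cons]; omega)
    simpa using this

/-! ### Location of the roots of $Tf$ -/

/-- The operator `f ↦ f + ∑ αₖ f⁽ᵏ⁾` on all polynomials. -/
noncomputable def diffSum (n : ℕ) (α : ℕ → ℂ) : ℂ[X] →ₗ[ℂ] ℂ[X] :=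
  LinearMap.id + ∑ k ∈ Finset.Icc 2 n, α k • (derivative (R := ℂ)) ^ k

theorem diffSum_apply (n : ℕ) (α : ℕ → ℂ) (f : ℂ[X]) :
    diffSum n α f = f + ∑ k ∈ Finset.Icc 2 n, α k • derivative^[k] f := by
  simp [diffSum, LinearMap.sum_apply, Module.End.pow_apply]

theorem coe_opT_eq_diffSum (n : ℕ) (α : ℕ → ℂ) (f : PolySpace n) :
    (opT n α f : ℂ[X]) = diffSum n α f := by
  rw [coe_opT, diffSum_apply]

theorem coeff_natDegree_diffSum (n : ℕ) (α : ℕ → ℂ) (f : ℂ[X]) :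
    (diffSum n α f).coeff f.natDegree = f.leadingCoeff := by
  rw [diffSum_apply, coeff_add, finsetSum_coeff, Finset.sum_eq_zero, add_zero]
  · rfl
  intro k hk
  have hk2 := (Finset.mem_Icc.1 hk).1
  rw [coeff_smul, coeff_iterate_derivative, coeff_eq_zero_of_natDegree_lt (by omega)]
  simp

theorem diffSum_ne_zero (n : ℕ) (α : ℕ → ℂ) {f : ℂ[X]} (hf : f ≠ 0) : diffSum n α f ≠ 0 := by
  intro h
  have := coeff_natDegree_diffSum n α f
  rw [h, coeff_zero] at this
  exact hf (leadingCoeff_eq_zero.1 this.symm)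

theorem derivative_diffSum (n : ℕ) (α : ℕ → ℂ) (f : ℂ[X]) :
    derivative (diffSum n α f) = diffSum n α (derivative f) := by
  simp only [diffSum_apply, derivative_add, derivative_sum, derivative_smul,
    ← Function.iterate_succ_apply', ← Function.iterate_succ_apply]

theorem eval_diffSum_X_sub_C_pow (n : ℕ) (α : ℕ → ℂ) (k : ℕ) (ζ w : ℂ) :
    (diffSum n α ((X - C ζ) ^ k)).eval w = (diffSum n α (X ^ k)).eval (w - ζ) := by
  simp only [diffSum_apply, iterate_derivative_X_sub_pow, iterate_derivative_X_pow_eq_natCast_mul,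
    eval_add, eval_finsetSum, eval_smul, eval_mul, eval_pow, eval_sub, eval_X, eval_C,
    eval_natCast, nsmul_eq_mul]

theorem maxShift_nonneg {n : ℕ} (T : Module.End ℂ (PolySpace n)) (f : PolySpace n) :
    0 ≤ maxShift T f :=
  Real.sInf_nonneg fun _ hr => hr.1.le

/-- `maxShift` of the top monomial bounds the roots of its image. -/
theorem norm_le_maxShift_of_isRoot {n : ℕ} (hn : n ≠ 0) (α : ℕ → ℂ) {w : ℂ}
    (hw : (diffSum n α (X ^ n)).eval w = 0) : ‖w‖ ≤ maxShift (opT n α) (monomialTop n) := by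
  have hroots : rootsOf (monomialTop n : ℂ[X]) = {0} := by
    ext z
    simp [rootsOf, monomialTop, hn]
  have hT : (opT n α (monomialTop n) : ℂ[X]) = diffSum n α (X ^ n) := coe_opT_eq_diffSum _ _ _
  have hne : diffSum n α (X ^ n) ≠ 0 := diffSum_ne_zero _ _ (pow_ne_zero _ X_ne_zero)
  unfold maxShift
  rw [hroots, hT]
  refine le_csInf ?_ ?_
  · obtain ⟨M, hM⟩ := ((diffSum n α (X ^ n)).roots.toFinset.image fun z => ‖z‖).bddAbove
    refine ⟨max M 1, by positivity, fun z hz => ?_⟩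
    rw [Set.singleton_add, Set.mem_image]
    refine ⟨z, ?_, zero_add z⟩
    rw [mem_closedBall_zero_iff]
    refine le_trans (hM ?_) (le_max_left _ _)
    simp only [Finset.coe_image, Set.mem_image, Finset.mem_coe, Multiset.mem_toFinset]
    exact ⟨z, (mem_roots hne).2 hz, rfl⟩
  · rintro r ⟨-, hr⟩
    obtain ⟨a, ha, b, hb, hab⟩ := hr hw
    simp only [Set.mem_singleton_iff] at ha
    simp only [ha, zero_add] at hab
    rwa [hab, mem_closedBall_zero_iff] at hb

/-- Since $T$ commutes with $D$, $TX^k$ is a multiple of $(TX^{k+1})'$. By Gauss–Lucas its roots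
stay in any disc containing those of $TX^{k+1}$. -/
theorem norm_le_of_isRoot_diffSum_X_pow {n : ℕ} {α : ℕ → ℂ} {R : ℝ}
    (hR : ∀ w, (diffSum n α (X ^ n)).eval w = 0 → ‖w‖ ≤ R) {k : ℕ} (hk : k ≤ n) :
    ∀ w, (diffSum n α (X ^ k)).eval w = 0 → ‖w‖ ≤ R := by
  induction hk using Nat.decreasingInduction with
  | self => exact hR
  | of_succ k hk ih =>
    intro w hw
    set P := diffSum n α (X ^ (k + 1)) with hP
    have hder : derivative P = ((k : ℂ) + 1) • diffSum n α (X ^ k) := by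
      rw [hP, derivative_diffSum, derivative_X_pow, Nat.add_sub_cancel, ← smul_eq_C_mul, map_smul]
      push_cast
      rfl
    have hdeg : 0 < P.degree := by
      have hc := coeff_natDegree_diffSum n α (X ^ (k + 1))
      rw [natDegree_X_pow, leadingCoeff_X_pow] at hc
      refine lt_of_lt_of_le ?_ (le_degree_of_ne_zero (n := k + 1) (by rw [hP, hc]; exact one_ne_zero))
      exact_mod_cast Nat.succ_pos k
    have hmem : w ∈ (derivative P).rootSet ℂ := by
      rw [mem_rootSet, coe_aeval_eq_eval]
      constructor
      · rw [hder]
        exact smul_ne_zero (by exact_mod_cast Nat.succ_ne_zero k)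
          (diffSum_ne_zero _ _ (pow_ne_zero _ X_ne_zero))
      · rw [hder, eval_smul, hw, smul_zero]
    have hsub : P.rootSet ℂ ⊆ Metric.closedBall 0 R := by
      intro z hz
      rw [mem_rootSet, coe_aeval_eq_eval] at hz
      rw [mem_closedBall_zero_iff]
      exact ih z hz.2
    have := convexHull_min hsub (convex_closedBall 0 R)
      (rootSet_derivative_subset_convexHull_rootSet hdeg hmem)
    rwa [mem_closedBall_zero_iff] at this

/-- Every root of `T f` is within `R_T(φₙ)` of a root of `f`. -/
theorem exists_root_norm_sub_le_maxShift {n : ℕ} (hn : n ≠ 0) (α : ℕ → ℂ) {f : ℂ[X]}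
    (hf : f ≠ 0) (hfn : f.natDegree ≤ n) {v : ℂ} (hv : (diffSum n α f).eval v = 0) :
    ∃ z, f.IsRoot z ∧ ‖v - z‖ ≤ maxShift (opT n α) (monomialTop n) := by
  by_contra! hcon
  set R := maxShift (opT n α) (monomialTop n)
  -- The disc is centred at $v$. By translation invariance the functional takes the value
  -- $(TX^k)(v-\zeta)$ on $(X-\zeta)^k$, nonzero as soon as $|\zeta-v|>R$.
  have hG := map_prod_X_sub_C_ne_zero (c := v) (maxShift_nonneg (opT n α) (monomialTop n)) f.roots
    (fun z hz => by rw [norm_sub_rev]; exact hcon z (isRoot_of_mem_roots hz))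
    (leval v ∘ₗ diffSum n α) (by
      intro k hk ζ hζ h0
      rw [IsAlgClosed.card_roots_eq_natDegree] at hk
      rw [LinearMap.comp_apply, leval_apply, eval_diffSum_X_sub_C_pow] at h0
      have := norm_le_of_isRoot_diffSum_X_pow (fun w => norm_le_maxShift_of_isRoot hn α)
        (hk.trans hfn) _ h0
      rw [norm_sub_rev] at this
      exact absurd this (not_le.2 hζ))
  apply hG
  have h2 := (IsAlgClosed.splits f).eq_prod_roots
  rw [h2, ← smul_eq_C_mul, map_smul, eval_smul, smul_eq_mul] at hv
  exact (mul_eq_zero.1 hv).resolve_left (leadingCoeff_ne_zero.2 hf)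

/-! ### The Grace–Heawood theorem -/

/-- A root of unity of order at most `n` which is close to `1` equals `1`. -/
theorem eq_one_of_pow_eq_one_of_norm_sub_one_lt {n N : ℕ} (hN : N ≠ 0) (hNn : N ≤ n) {ω : ℂ}
    (hω : ω ^ N = 1) (h : ‖ω - 1‖ < 2 * Real.sin (Real.pi / n)) : ω = 1 := by
  have : NeZero N := ⟨hN⟩
  have hprim := Complex.isPrimitiveRoot_exp N hN
  obtain ⟨j, hj, rfl⟩ := hprim.eq_pow_of_pow_eq_one hω
  rcases Nat.eq_zero_or_pos j with rfl | hj0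
  · simp
  exfalso
  have hNpos : (0 : ℝ) < N := by exact_mod_cast Nat.pos_of_ne_zero hN
  have hnN : (N : ℝ) ≤ n := by exact_mod_cast hNn
  have hj1 : (1 : ℝ) ≤ j := by exact_mod_cast hj0
  have hjN : (j : ℝ) + 1 ≤ N := by exact_mod_cast hj
  have e : Complex.exp (2 * Real.pi * Complex.I / N) ^ j =
      Complex.exp (Complex.I * ((2 * (Real.pi * j / N) : ℝ) : ℂ)) := by
    rw [← Complex.exp_nat_mul]
    congr 1
    push_cast
    ring
  rw [e, Complex.norm_exp_I_mul_ofReal_sub_one, mul_div_cancel_left₀ _ two_ne_zero, norm_mul,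
    Real.norm_of_nonneg (by norm_num : (0 : ℝ) ≤ 2), Real.norm_eq_abs] at h
  have hpi := Real.pi_pos
  -- For $0<j<N$ the half-angle $\pi j/N$ lies in $[\pi/n,\pi-\pi/n]$, where the sine is at least
  -- $\sin(\pi/n)$.
  have h1 : Real.pi / n ≤ Real.pi / N := by gcongr
  have h2 : Real.pi / N ≤ Real.pi * j / N := by
    gcongr
    nlinarith
  have h3 : Real.pi * j / N ≤ Real.pi - Real.pi / N := by
    rw [le_sub_iff_add_le, ← add_div, div_le_iff₀ hNpos]
    nlinarith
  have h4 : Real.sin (Real.pi / n) ≤ Real.sin (Real.pi * j / N) := by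
    rcases le_total (Real.pi * j / N) (Real.pi / 2) with hle | hle
    · apply Real.sin_le_sin_of_le_of_le_pi_div_two _ hle (h1.trans h2)
      have : 0 ≤ Real.pi / n := by positivity
      linarith
    · rw [← Real.sin_pi_sub (Real.pi * j / N)]
      apply Real.sin_le_sin_of_le_of_le_pi_div_two
      · have : 0 ≤ Real.pi / n := by positivity
        linarith
      · linarith
      · linarith
  have := le_abs_self (Real.sin (Real.pi * j / N))
  linarith

theorem derivative_surjective_complex : Function.Surjective (derivative (R := ℂ)) := by
  intro p
  induction p using Polynomial.induction_on' with
  | add p q hp hq =>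
    obtain ⟨a, rfl⟩ := hp
    obtain ⟨b, rfl⟩ := hq
    exact ⟨a + b, derivative_add⟩
  | monomial k a =>
    refine ⟨monomial (k + 1) (a / (k + 1)), ?_⟩
    rw [derivative_monomial]
    congr 1
    have : (k : ℂ) + 1 ≠ 0 := by exact_mod_cast Nat.succ_ne_zero k
    push_cast
    field_simp

/-- The linear functional `g ↦ ∫ g` over the segment between two points. -/
theorem exists_integral_functional (w₁ w₂ : ℂ) : ∃ L : ℂ[X] →ₗ[ℂ] ℂ,
    ∀ h : ℂ[X], L (derivative h) = h.eval w₂ - h.eval w₁ := by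
  obtain ⟨S, hS⟩ := (derivative (R := ℂ)).exists_rightInverse_of_surjective
    (LinearMap.range_eq_top.2 derivative_surjective_complex)
  refine ⟨(leval w₂ - leval w₁) ∘ₗ S, fun h => ?_⟩
  have h1 : derivative (S (derivative h)) = derivative h := LinearMap.congr_fun hS _
  have h2 : derivative (S (derivative h) - h) = 0 := by rw [derivative_sub, h1, sub_self]
  have h3 := eq_C_of_derivative_eq_zero h2
  have h4 : S (derivative h) = h + C ((S (derivative h) - h).coeff 0) := by
    rw [← h3]; ring
  rw [LinearMap.comp_apply, h4]
  simp [leval_apply]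

/-- A form of the Grace–Heawood theorem: near a root at distance `δ` from another root there is a
critical point at distance at most `δ / sin (π / n)`. -/
theorem exists_critical_point {n : ℕ} (hn : 2 ≤ n) {f : ℂ[X]} (hf : 0 < f.natDegree)
    (hfn : f.natDegree ≤ n) {w₁ w₂ : ℂ} (hne : w₁ ≠ w₂) (h₁ : f.eval w₁ = 0) (h₂ : f.eval w₂ = 0) :
    ∃ c, (derivative f).IsRoot c ∧ ‖c - w₁‖ * Real.sin (Real.pi / n) ≤ ‖w₂ - w₁‖ := by
  have hn0 : (2 : ℝ) ≤ n := by exact_mod_cast hn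
  have hpi := Real.pi_pos
  have hsin : 0 < Real.sin (Real.pi / n) := by
    apply Real.sin_pos_of_pos_of_lt_pi (by positivity)
    rw [div_lt_iff₀ (by linarith)]
    nlinarith
  have hr : 0 ≤ ‖w₂ - w₁‖ / Real.sin (Real.pi / n) := by positivity
  by_contra! hcon
  obtain ⟨L, hL⟩ := exists_integral_functional w₁ w₂
  have hdeg := natDegree_derivative_lt hf.ne'
  have hG := map_prod_X_sub_C_ne_zero (c := w₁) hr (derivative f).roots
    (fun z hz => by
      rw [div_lt_iff₀ hsin]
      exact hcon z (isRoot_of_mem_roots hz)) L (by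
      intro k hk ζ hζ h0
      rw [IsAlgClosed.card_roots_eq_natDegree] at hk
      have hder : derivative ((X - C ζ) ^ (k + 1)) = ((k : ℂ) + 1) • (X - C ζ) ^ k := by
        rw [derivative_X_sub_C_pow, smul_eq_C_mul]
        simp
      have h5 := hL ((X - C ζ) ^ (k + 1))
      rw [hder, map_smul, h0, smul_zero] at h5
      simp only [eval_pow, eval_sub, eval_X, eval_C] at h5
      have hζ' : w₁ - ζ ≠ 0 := by
        intro h6
        rw [← sub_eq_zero.1 h6, sub_self, norm_zero] at hζ
        linarith
      -- Vanishing of $L$ on $(X-\zeta)^k$ makes this ratio a root of unity of order at most $n$.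
      -- Its distance to $1$ is $|w_2-w_1|/|\zeta-w_1|<\sin(\pi/n)$, so it is $1$, contradicting
      -- $w_1\ne w_2$.
      have h6 : ((w₂ - ζ) / (w₁ - ζ)) ^ (k + 1) = 1 := by
        rw [div_pow, sub_eq_zero.1 h5.symm, div_self (pow_ne_zero _ hζ')]
      have h7 : (w₂ - ζ) / (w₁ - ζ) - 1 = (w₂ - w₁) / (w₁ - ζ) := by
        field_simp; ring
      have h8 := eq_one_of_pow_eq_one_of_norm_sub_one_lt (n := n) (Nat.succ_ne_zero k) (by omega) h6 (by
        rw [h7, norm_div, div_lt_iff₀ (norm_pos_iff.2 hζ'), norm_sub_rev w₁ ζ]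
        rw [div_lt_iff₀ hsin] at hζ
        nlinarith [norm_nonneg (w₂ - w₁), norm_nonneg (ζ - w₁)])
      rw [h8, sub_self] at h7
      rcases div_eq_zero_iff.1 h7.symm with h9 | h9
      · exact hne (sub_eq_zero.1 h9).symm
      · exact hζ' h9)
  apply hG
  have h3 := hL f
  have h2 := (IsAlgClosed.splits (derivative f)).eq_prod_roots
  rw [h₁, h₂, sub_zero, h2, ← smul_eq_C_mul, map_smul, smul_eq_mul] at h3
  refine (mul_eq_zero.1 h3).resolve_left (leadingCoeff_ne_zero.2 fun h0 => ?_)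
  exact hf.ne' (derivative_eq_zero.1 h0)

/-! ### The one-sided estimate and separation of roots -/

theorem tau_nonneg (f : ℂ[X]) : 0 ≤ tau f := by
  apply Real.sInf_nonneg
  rintro d ⟨w, -, v, -, rfl⟩
  exact norm_nonneg _

theorem tau_le {f : ℂ[X]} {w v : ℂ} (hw : f.IsRoot w) (hv : (derivative f).IsRoot v)
    (hne : v ≠ w) : tau f ≤ ‖w - v‖ := by
  refine csInf_le ⟨0, ?_⟩ ⟨w, hw, v, ⟨hv, hne⟩, rfl⟩
  rintro d ⟨w, -, v, -, rfl⟩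
  exact norm_nonneg _

theorem ne_of_isRoot_of_isRoot_derivative {f : ℂ[X]} (hf : f ≠ 0) (hs : f.roots.Nodup) {w v : ℂ}
    (hw : f.IsRoot w) (hv : (derivative f).IsRoot v) : v ≠ w := by
  rintro rfl
  have h1 := (one_lt_rootMultiplicity_iff_isRoot hf).2 ⟨hw, hv⟩
  have h2 := Multiset.nodup_iff_count_le_one.1 hs v
  rw [count_roots] at h2
  omega

/-- This is monotonicity of $((1+x)^N-1)/x$, cleared of denominators. It later replaces $t$ by its
lower bound $R+1$ in $t((1+1/t)^N-1)$. -/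
theorem mul_one_add_pow_sub_one_le {x y : ℝ} (hx : 0 ≤ x) (hxy : x ≤ y) (N : ℕ) :
    y * ((1 + x) ^ N - 1) ≤ x * ((1 + y) ^ N - 1) := by
  induction N with
  | zero => simp
  | succ N ih =>
    have h1 : (1 + x) ^ N ≤ (1 + y) ^ N := by gcongr
    have h2 : 0 ≤ x * y := mul_nonneg hx (hx.trans hxy)
    have := mul_le_mul_of_nonneg_left h1 h2
    rw [pow_succ, pow_succ]
    linarith

theorem sum_Icc_choose_mul_pow (N : ℕ) (x : ℝ) :
    ∑ k ∈ Finset.Icc 2 (N + 1), (N.choose (k - 1) : ℝ) * x ^ (k - 1) = (1 + x) ^ N - 1 := by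
  rw [add_comm 1 x, add_pow, Finset.sum_range_succ']
  simp only [one_pow, mul_one, pow_zero, Nat.choose_zero_right, Nat.cast_one,
    add_sub_cancel_right]
  refine Finset.sum_nbij' (fun k => k - 2) (fun k => k + 2) ?_ ?_ ?_ ?_ ?_
  · intro k hk; simp at hk ⊢; omega
  · intro k hk; simp at hk ⊢; omega
  · intro k hk; simp at hk ⊢; omega
  · intro k hk; simp
  · intro k hk
    have hk2 := (Finset.mem_Icc.1 hk).1
    have : k - 2 + 1 = k - 1 := by omega
    rw [this]; ring

theorem le_iSup_coeff (n : ℕ) (α : ℕ → ℂ) {k : ℕ} (hk : k ∈ Finset.Icc 2 n) :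
    ‖α k‖ * (k - 1)! ≤ ⨆ k : Finset.Icc 2 n, ‖α k‖ * ((k : ℕ) - 1)! :=
  le_ciSup (f := fun k : Finset.Icc 2 n => ‖α k‖ * (((k : ℕ) - 1)! : ℝ))
    (Set.finite_range _).bddAbove ⟨k, hk⟩

/-- Estimate of `f` by `f'` at a root of `T f` away from the critical points of `f`. -/
theorem norm_eval_le_of_eval_diffSum_eq_zero {N : ℕ} (α : ℕ → ℂ) {f : ℂ[X]}
    (hfn : f.natDegree ≤ N + 1) {v : ℂ} (hv : (diffSum (N + 1) α f).eval v = 0) {t : ℝ}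
    (ht : 0 < t) (hcrit : ∀ c, (derivative f).IsRoot c → t ≤ ‖v - c‖) :
    ‖f.eval v‖ ≤ (⨆ k : Finset.Icc 2 (N + 1), ‖α k‖ * ((k : ℕ) - 1)!) *
      ((1 + 1 / t) ^ N - 1) * ‖(derivative f).eval v‖ := by
  rw [diffSum_apply, eval_add, eval_finsetSum] at hv
  rw [eq_neg_of_add_eq_zero_left hv, norm_neg, ← sum_Icc_choose_mul_pow, Finset.mul_sum,
    Finset.sum_mul]
  refine (norm_sum_le _ _).trans (Finset.sum_le_sum fun k hk => ?_)
  have hk2 := (Finset.mem_Icc.1 hk).1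
  rw [eval_smul, norm_smul]
  have h1 := norm_iterate_derivative_eval_le (derivative f) v ht.le hcrit (k - 1)
  rw [← Function.iterate_succ_apply, Nat.succ_eq_add_one, Nat.sub_add_cancel (by omega)] at h1
  have hdeg : (derivative f).natDegree ≤ N := by
    have := natDegree_derivative_le f
    omega
  have h2 : ((derivative f).natDegree.choose (k - 1) : ℝ) ≤ N.choose (k - 1) := by
    exact_mod_cast Nat.choose_le_choose _ hdeg
  have htk : 0 < t ^ (k - 1) := by positivity
  have h3 : ‖(derivative^[k] f).eval v‖ ≤
      (k - 1)! * ((N.choose (k - 1) * (1 / t) ^ (k - 1)) * ‖(derivative f).eval v‖) := by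
    rw [← mul_le_mul_iff_left₀ htk]
    refine h1.trans ?_
    have : (k - 1)! * ((N.choose (k - 1) * (1 / t) ^ (k - 1)) * ‖(derivative f).eval v‖) *
        t ^ (k - 1) = (k - 1)! * (N.choose (k - 1) * ‖(derivative f).eval v‖) := by
      rw [one_div, inv_pow]
      field_simp
    rw [this]
    gcongr
  calc _ ≤ ‖α k‖ * ((k - 1)! * ((N.choose (k - 1) * (1 / t) ^ (k - 1)) *
        ‖(derivative f).eval v‖)) := by gcongr
    _ = (‖α k‖ * (k - 1)!) * (N.choose (k - 1) * (1 / t) ^ (k - 1)) *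
        ‖(derivative f).eval v‖ := by ring
    _ ≤ _ := by
      gcongr
      exact le_iSup_coeff _ _ hk

/-- The one-sided estimate `τ(f) R_T(f) ≤ Γ_T`. -/
theorem exists_root_tau_mul_norm_sub_le {n : ℕ} (hn : n ≠ 0) (α : ℕ → ℂ) {f : ℂ[X]}
    (hf : 0 < f.natDegree) (hfn : f.natDegree ≤ n) (hs : f.roots.Nodup) {v : ℂ}
    (hv : (diffSum n α f).eval v = 0) :
    ∃ z, f.IsRoot z ∧ tau f * ‖v - z‖ ≤ Gamma n α := by
  have hf0 : f ≠ 0 := by rintro rfl; simp at hf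
  obtain ⟨N, rfl⟩ := Nat.exists_eq_succ_of_ne_zero hn
  rw [Nat.succ_eq_add_one] at *
  obtain ⟨z₀, hz₀, hvz₀⟩ := exists_root_norm_sub_le_maxShift hn α hf0 hfn hv
  unfold Gamma GammaAux
  set R := maxShift (opT (N + 1) α) (monomialTop (N + 1))
  have hR : 0 ≤ R := maxShift_nonneg _ _
  -- Below the threshold $2R+1$ the bound $\|v-z_0\|\le R$ gives the first entry of $\Gamma_T$.
  -- Above it, $t=\tau(f)-R\ge R+1$ bounds the distance from $v$ to the critical points, and
  -- $\tau(f)\le 2t$ accounts for the factor 2 in the second entry.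
  rcases lt_or_ge (tau f) (2 * R + 1) with hlt | hge
  · refine ⟨z₀, hz₀, le_max_of_le_left ?_⟩
    have := tau_nonneg f
    nlinarith [norm_nonneg (v - z₀)]
  set t := tau f - R with ht
  have htR : R + 1 ≤ t := by linarith
  have ht0 : 0 < t := by linarith
  have hcrit : ∀ c, (derivative f).IsRoot c → t ≤ ‖v - c‖ := by
    intro c hc
    have h1 := tau_le hz₀ hc (ne_of_isRoot_of_isRoot_derivative hf0 hs hz₀ hc)
    have h2 : ‖z₀ - c‖ ≤ ‖v - z₀‖ + ‖v - c‖ := by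
      rw [norm_sub_rev v z₀]
      exact norm_sub_le_norm_sub_add_norm_sub _ _ _
    linarith
  have hd0 : 0 < ‖(derivative f).eval v‖ := by
    rw [norm_pos_iff]
    intro h0
    have := hcrit v h0
    rw [sub_self, norm_zero] at this
    linarith
  have h1 := norm_eval_le_of_eval_diffSum_eq_zero α hfn hv ht0 hcrit
  set M := ⨆ k : Finset.Icc 2 (N + 1), ‖α k‖ * (((k : ℕ) - 1)! : ℝ)
  have hM : 0 ≤ M := Real.iSup_nonneg fun k => by positivity
  have h2 : t * ((1 + 1 / t) ^ N - 1) ≤ (R + 1) * (((R + 2) / (R + 1)) ^ N - 1) := by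
    have h3 := mul_one_add_pow_sub_one_le (x := 1 / t) (y := 1 / (R + 1)) (by positivity)
      (one_div_le_one_div_of_le (by linarith) htR) N
    have h4 : 1 + 1 / (R + 1) = (R + 2) / (R + 1) := by
      have : R + 1 ≠ 0 := by linarith
      field_simp
      ring
    rw [h4, one_div_mul_eq_div, one_div_mul_eq_div, div_le_div_iff₀ (by linarith) ht0] at h3
    linarith
  have hne : f.roots.toFinset.Nonempty := ⟨z₀, by
    rw [Multiset.mem_toFinset]; exact (mem_roots hf0).2 hz₀⟩
  obtain ⟨z, hz, hzmin⟩ := f.roots.toFinset.exists_min_image (fun z => ‖v - z‖) hne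
  rw [Multiset.mem_toFinset] at hz
  refine ⟨z, isRoot_of_mem_roots hz, le_max_of_le_right ?_⟩
  -- At the root $z$ nearest to $v$ this is $|f'(v)|\,|v-z|\le\deg f\cdot|f(v)|$. Combined with
  -- `h1`, the factor $|f'(v)|$ cancels.
  have h5 := norm_iterate_derivative_eval_le f v (norm_nonneg (v - z))
    (fun y hy => hzmin y (by rw [Multiset.mem_toFinset]; exact (mem_roots hf0).2 hy)) 1
  simp only [Function.iterate_one, pow_one, Nat.factorial_one, Nat.cast_one, one_mul,
    Nat.choose_one_right] at h5
  have h6 : (f.natDegree : ℝ) ≤ ((N + 1 : ℕ) : ℝ) := by exact_mod_cast hfn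
  have h7 : t * ‖v - z‖ ≤ ((N + 1 : ℕ) : ℝ) * M * (R + 1) * (((R + 2) / (R + 1)) ^ N - 1) := by
    rw [← mul_le_mul_iff_left₀ hd0]
    calc t * ‖v - z‖ * ‖(derivative f).eval v‖
        = t * (‖(derivative f).eval v‖ * ‖v - z‖) := by ring
      _ ≤ t * (((N + 1 : ℕ) : ℝ) * (M * ((1 + 1 / t) ^ N - 1) * ‖(derivative f).eval v‖)) := by
        refine mul_le_mul_of_nonneg_left (h5.trans ?_) ht0.le
        gcongr
      _ = ((N + 1 : ℕ) : ℝ) * M * (t * ((1 + 1 / t) ^ N - 1)) * ‖(derivative f).eval v‖ := by ring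
      _ ≤ ((N + 1 : ℕ) : ℝ) * M * ((R + 1) * (((R + 2) / (R + 1)) ^ N - 1)) *
          ‖(derivative f).eval v‖ := by gcongr
      _ = _ := by ring
  rw [Nat.add_sub_cancel]
  have h8 : tau f ≤ 2 * t := by linarith
  nlinarith [norm_nonneg (v - z)]

/-- Distinct roots are at distance at least `τ(f) sin (π / n)`. -/
theorem tau_mul_sin_le {n : ℕ} (hn : 2 ≤ n) {f : ℂ[X]} (hf : 0 < f.natDegree)
    (hfn : f.natDegree ≤ n) (hs : f.roots.Nodup) {w₁ w₂ : ℂ} (hne : w₁ ≠ w₂)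
    (h₁ : f.IsRoot w₁) (h₂ : f.IsRoot w₂) : tau f * Real.sin (Real.pi / n) ≤ ‖w₂ - w₁‖ := by
  have hf0 : f ≠ 0 := by rintro rfl; simp at hf
  obtain ⟨c, hc, hle⟩ := exists_critical_point hn hf hfn hne h₁ h₂
  refine le_trans ?_ hle
  have hsin : 0 ≤ Real.sin (Real.pi / n) := by
    apply Real.sin_nonneg_of_nonneg_of_le_pi (by positivity)
    apply div_le_self Real.pi_pos.le
    exact_mod_cast (by omega : 1 ≤ n)
  rw [norm_sub_rev]
  gcongr
  exact tau_le h₁ hc (ne_of_isRoot_of_isRoot_derivative hf0 hs h₁ hc)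

/-! ### Matching roots along a segment of polynomials -/

theorem exists_map_univ_eq (A : Multiset ℂ) {m : ℕ} (h : Multiset.card A = m) :
    ∃ u : Fin m → ℂ, Finset.univ.val.map u = A := by
  subst h
  obtain ⟨l, rfl⟩ := Quot.exists_rep A
  refine ⟨fun i => l.get i, ?_⟩
  rw [Fin.univ_val_map]
  exact congrArg _ (List.ofFn_get l)

theorem roots_C_mul_prod_X_sub_C {m : ℕ} {a : ℂ} (ha : a ≠ 0) (u : Fin m → ℂ) :
    (C a * ∏ i, (X - C (u i))).roots = Finset.univ.val.map u := by
  rw [roots_C_mul _ ha]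
  have : ∏ i, (X - C (u i)) = ((Finset.univ.val.map u).map fun z => X - C z).prod := by
    rw [Multiset.map_map]; rfl
  rw [this, roots_multiset_prod_X_sub_C]

theorem exists_eq_C_mul_prod_X_sub_C (p : ℂ[X]) {m : ℕ} (hm : p.natDegree = m) :
    ∃ u : Fin m → ℂ, p = C p.leadingCoeff * ∏ i, (X - C (u i)) := by
  obtain ⟨u, hu⟩ := exists_map_univ_eq p.roots
    ((IsAlgClosed.card_roots_eq_natDegree).trans hm)
  refine ⟨u, ?_⟩
  conv_lhs => rw [(IsAlgClosed.splits p).eq_prod_roots, ← hu, Multiset.map_map]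
  rfl

/-- The graph joining two indices when the corresponding points are at distance at most `δ`. -/
def proximityGraph {m : ℕ} (z : Fin m → ℂ) (δ : ℝ) : SimpleGraph (Fin m) where
  Adj i j := i ≠ j ∧ ‖z i - z j‖ ≤ δ
  symm := ⟨fun i j h => ⟨h.1.symm, by rw [norm_sub_rev]; exact h.2⟩⟩
  loopless := ⟨fun _ h => h.1 rfl⟩

theorem norm_sub_le_of_reachable {m : ℕ} {z : Fin m → ℂ} {δ : ℝ} (hδ : 0 ≤ δ) {i j : Fin m}
    (h : (proximityGraph z δ).Reachable i j) : ‖z i - z j‖ ≤ m * δ := by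
  classical
  obtain ⟨p, hp⟩ := h.exists_isPath
  have hlen := hp.length_lt
  rw [Fintype.card_fin] at hlen
  have key : ∀ {i j : Fin m} (p : (proximityGraph z δ).Walk i j),
      ‖z i - z j‖ ≤ p.length * δ := by
    intro i j p
    induction p with
    | nil => simp
    | cons hadj p ih =>
      rw [SimpleGraph.Walk.length_cons]
      refine (norm_sub_le_norm_sub_add_norm_sub _ _ _).trans ((add_le_add hadj.2 ih).trans ?_)
      push_cast
      linarith
  refine (key p).trans ?_
  gcongr

/-- The union of the closed discs of radius `ρ` about the points of one cluster. -/
def clusterSet {m : ℕ} (z : Fin m → ℂ) (ρ : ℝ)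
    (c : (proximityGraph z (2 * ρ)).ConnectedComponent) : Set ℂ :=
  ⋃ i ∈ {i | (proximityGraph z (2 * ρ)).connectedComponentMk i = c}, Metric.closedBall (z i) ρ

theorem mem_clusterSet {m : ℕ} {z : Fin m → ℂ} {ρ : ℝ}
    {c : (proximityGraph z (2 * ρ)).ConnectedComponent} {w : ℂ} :
    w ∈ clusterSet z ρ c ↔
      ∃ i, (proximityGraph z (2 * ρ)).connectedComponentMk i = c ∧ ‖w - z i‖ ≤ ρ := by
  simp [clusterSet, dist_eq_norm]

theorem isCompact_clusterSet {m : ℕ} (z : Fin m → ℂ) (ρ : ℝ)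
    (c : (proximityGraph z (2 * ρ)).ConnectedComponent) : IsCompact (clusterSet z ρ c) :=
  (Set.toFinite _).isCompact_biUnion fun _ _ => isCompact_closedBall _ _

/-- Two discs of radius $\rho$ that meet have centres within $2\rho$, which is why the graph uses
that threshold. -/
theorem eq_of_mem_clusterSet {m : ℕ} {z : Fin m → ℂ} {ρ : ℝ}
    {c c' : (proximityGraph z (2 * ρ)).ConnectedComponent} {w : ℂ}
    (h : w ∈ clusterSet z ρ c) (h' : w ∈ clusterSet z ρ c') : c = c' := by
  obtain ⟨i, rfl, hi⟩ := mem_clusterSet.1 h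
  obtain ⟨j, rfl, hj⟩ := mem_clusterSet.1 h'
  by_cases hij : i = j
  · rw [hij]
  · refine SimpleGraph.ConnectedComponent.sound (SimpleGraph.Adj.reachable ⟨hij, ?_⟩)
    have := norm_sub_le_norm_sub_add_norm_sub (z i) w (z j)
    rw [norm_sub_rev (z i) w] at this
    linarith

/-- The parameters `s` for which the roots of `f + s (g - f)` can be enumerated with the `i`-th
root in the cluster `κ i`. -/
def clusterParams {m : ℕ} (f g : ℂ[X]) (a : ℂ) (z : Fin m → ℂ) (ρ : ℝ)
    (κ : Fin m → (proximityGraph z (2 * ρ)).ConnectedComponent) : Set ℝ :=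
  {s | s ∈ Set.Icc (0 : ℝ) 1 ∧ ∃ u : Fin m → ℂ, (∀ i, u i ∈ clusterSet z ρ (κ i)) ∧
    ∀ w, a * ∏ i, (w - u i) = f.eval w + s * (g.eval w - f.eval w)}

/-- The set is the projection of a compact set of pairs (parameter, enumeration), so no continuous
choice of roots is needed. -/
theorem isClosed_clusterParams {m : ℕ} (f g : ℂ[X]) (a : ℂ) (z : Fin m → ℂ) (ρ : ℝ)
    (κ : Fin m → (proximityGraph z (2 * ρ)).ConnectedComponent) :
    IsClosed (clusterParams f g a z ρ κ) := by
  have hK : IsCompact (Set.Icc (0 : ℝ) 1 ×ˢ Set.univ.pi fun i => clusterSet z ρ (κ i)) :=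
    isCompact_Icc.prod (isCompact_univ_pi fun i => isCompact_clusterSet z ρ (κ i))
  have hC : IsClosed {x : ℝ × (Fin m → ℂ) |
      ∀ w, a * ∏ i, (w - x.2 i) = f.eval w + x.1 * (g.eval w - f.eval w)} := by
    rw [Set.ofPred_forall]
    refine isClosed_iInter fun w => isClosed_eq ?_ ?_ <;> fun_prop
  have := ((hK.inter_right hC).image continuous_fst).isClosed
  convert this using 1
  ext s
  constructor
  · rintro ⟨hs, u, hu, h⟩
    exact ⟨(s, u), ⟨⟨hs, fun i _ => hu i⟩, h⟩, rfl⟩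
  · rintro ⟨⟨s, u⟩, ⟨⟨hs, hu⟩, h⟩, rfl⟩
    exact ⟨hs, u, fun i => hu i trivial, h⟩

theorem clusterParams_comp_perm {m : ℕ} {f g : ℂ[X]} {a : ℂ} {z : Fin m → ℂ} {ρ : ℝ}
    {κ : Fin m → (proximityGraph z (2 * ρ)).ConnectedComponent} (π : Equiv.Perm (Fin m)) {s : ℝ}
    (h : s ∈ clusterParams f g a z ρ (κ ∘ π)) : s ∈ clusterParams f g a z ρ κ := by
  obtain ⟨hs, u, hu, h⟩ := h
  refine ⟨hs, u ∘ π.symm, fun i => by simpa using hu (π.symm i), fun w => ?_⟩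
  rw [← h w]
  congr 1
  exact Equiv.prod_comp π.symm fun i => w - u i

theorem exists_perm_of_mem_clusterParams {m : ℕ} {f g : ℂ[X]} {a : ℂ} (ha : a ≠ 0)
    {z : Fin m → ℂ} {ρ : ℝ} {κ κ' : Fin m → (proximityGraph z (2 * ρ)).ConnectedComponent} {s : ℝ}
    (h : s ∈ clusterParams f g a z ρ κ) (h' : s ∈ clusterParams f g a z ρ κ') :
    ∃ π : Equiv.Perm (Fin m), κ' = κ ∘ π := by
  obtain ⟨-, u, hu, h⟩ := h
  obtain ⟨-, u', hu', h'⟩ := h'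
  have hp : C a * ∏ i, (X - C (u i)) = C a * ∏ i, (X - C (u' i)) := by
    refine Polynomial.funext fun w => ?_
    simpa [eval_prod] using (h w).trans (h' w).symm
  have hroots := congrArg roots hp
  rw [roots_C_mul_prod_X_sub_C ha, roots_C_mul_prod_X_sub_C ha] at hroots
  obtain ⟨π, rfl⟩ := exists_perm_of_map_eq hroots
  exact ⟨π, funext fun i => eq_of_mem_clusterSet (hu' i) (hu (π i))⟩

/-- If along the segment from `f` to `g` the roots stay within `ρ` of the roots of `f`, then the
roots of `g` can be matched with those of `f` within a distance controlled by `ρ`. -/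
theorem exists_matching_of_segment {m : ℕ} {f g : ℂ[X]} {a : ℂ} (ha : a ≠ 0) (z : Fin m → ℂ)
    {ρ : ℝ} (hρ : 0 ≤ ρ) (hf : f = C a * ∏ i, (X - C (z i)))
    (hdeg : ∀ s : ℝ, (f + C (s : ℂ) * (g - f)).natDegree = m ∧
      (f + C (s : ℂ) * (g - f)).leadingCoeff = a)
    (hnear : ∀ s ∈ Set.Icc (0 : ℝ) 1, ∀ w, f.eval w + s * (g.eval w - f.eval w) = 0 →
      ∃ i, ‖w - z i‖ ≤ ρ) :
    ∃ u : Fin m → ℂ, g = C a * ∏ i, (X - C (u i)) ∧ ∀ i, ‖z i - u i‖ ≤ m * (2 * ρ) + ρ := by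
  set G := proximityGraph z (2 * ρ)
  set A := clusterParams f g a z ρ G.connectedComponentMk with hA
  -- `A` holds the parameters with the initial number of roots in each cluster, `B` those with a
  -- different distribution. Both are closed, they cover $[0,1]$, and they are disjoint because the
  -- distribution is determined by the polynomial; connectedness then carries $0\in A$ to $1\in A$.
  set B := ⋃ κ ∈ {κ : Fin m → G.ConnectedComponent | ¬ ∃ π : Equiv.Perm (Fin m),
    κ = G.connectedComponentMk ∘ π}, clusterParams f g a z ρ κ with hB
  have hAc : IsClosed A := isClosed_clusterParams _ _ _ _ _ _
  have hBc : IsClosed B :=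
    (Set.toFinite _).isClosed_biUnion fun κ _ => isClosed_clusterParams _ _ _ _ _ _
  have hcover : Set.Icc (0 : ℝ) 1 ⊆ A ∪ B := by
    intro s hs
    obtain ⟨u, hu⟩ := exists_eq_C_mul_prod_X_sub_C _ (hdeg s).1
    rw [(hdeg s).2] at hu
    have hev : ∀ w, a * ∏ i, (w - u i) = f.eval w + s * (g.eval w - f.eval w) := by
      intro w
      have := congrArg (eval w) hu
      simpa [eval_prod] using this.symm
    have hκ : ∀ i, ∃ c : G.ConnectedComponent, u i ∈ clusterSet z ρ c := by
      intro i
      obtain ⟨j, hj⟩ := hnear s hs (u i) (by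
        rw [← hev, Finset.prod_eq_zero (Finset.mem_univ i) (sub_self _), mul_zero])
      exact ⟨_, mem_clusterSet.2 ⟨j, rfl, hj⟩⟩
    choose κ hκ using hκ
    have hmem : s ∈ clusterParams f g a z ρ κ := ⟨hs, u, hκ, hev⟩
    by_cases hπ : ∃ π : Equiv.Perm (Fin m), κ = G.connectedComponentMk ∘ π
    · obtain ⟨π, rfl⟩ := hπ
      exact Or.inl (clusterParams_comp_perm π hmem)
    · exact Or.inr (Set.mem_biUnion (x := κ) hπ hmem)
  have h0 : (0 : ℝ) ∈ A := by
    refine ⟨by simp, z, fun i => mem_clusterSet.2 ⟨i, rfl, by simpa using hρ⟩, fun w => ?_⟩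
    rw [hf]
    simp [eval_prod]
  have hone : (1 : ℝ) ∈ Set.Icc (0 : ℝ) 1 := by simp
  have h1 : (1 : ℝ) ∈ A := by
    by_contra hcon
    have h1B := (hcover hone).resolve_left hcon
    obtain ⟨s, -, hsA, hsB⟩ := isPreconnected_closed_iff.1 (isPreconnected_Icc (a := (0 : ℝ))
      (b := 1)) A B hAc hBc hcover ⟨0, by simp, h0⟩ ⟨1, hone, h1B⟩
    obtain ⟨κ, hκ, hsκ⟩ := Set.mem_iUnion₂.1 hsB
    exact hκ (exists_perm_of_mem_clusterParams ha hsA hsκ)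
  obtain ⟨-, u, hu, hev⟩ := h1
  refine ⟨u, Polynomial.funext fun w => ?_, fun i => ?_⟩
  · have := hev w
    simp only [Complex.ofReal_one, one_mul, add_sub_cancel] at this
    simp [eval_prod, ← this]
  · obtain ⟨j, hj, hju⟩ := mem_clusterSet.1 (hu i)
    have h2 := norm_sub_le_of_reachable (by positivity)
      (SimpleGraph.ConnectedComponent.exact hj.symm)
    have h3 := norm_sub_le_norm_sub_add_norm_sub (z i) (z j) (u i)
    rw [norm_sub_rev (z j) (u i)] at h3
    linarith

/-! ### Existence of $K_F(T)$ -/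

/-- Roots of `f + s (T f - f)` stay near those of `f`. -/
theorem exists_root_norm_sub_le_of_segment {n : ℕ} (α : ℕ → ℂ) {f : ℂ[X]}
    (hfn : f.natDegree ≤ n) {s : ℝ} (hs : s ∈ Set.Icc (0 : ℝ) 1) {w : ℂ}
    (hw : f.eval w + s * ((diffSum n α f).eval w - f.eval w) = 0) :
    ∃ z, f.IsRoot z ∧ ‖w - z‖ ≤ 1 + ∑ k ∈ Finset.Icc 2 n, ‖α k‖ * (k ! * n.choose k) := by
  by_contra! hcon
  set S := ∑ k ∈ Finset.Icc 2 n, ‖α k‖ * ((k ! : ℝ) * n.choose k) with hS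
  have hS0 : 0 ≤ S := Finset.sum_nonneg fun k _ => by positivity
  have hfw : 0 < ‖f.eval w‖ := by
    rw [norm_pos_iff]
    intro h0
    have := hcon w h0
    rw [sub_self, norm_zero] at this
    linarith
  have hterm : ∀ k ∈ Finset.Icc 2 n, ‖(α k • derivative^[k] f).eval w‖ * (1 + S) ≤
      ‖α k‖ * (k ! * n.choose k) * ‖f.eval w‖ := by
    intro k hk
    have hk2 := (Finset.mem_Icc.1 hk).1
    have h1 := norm_iterate_derivative_eval_le f w (d := 1 + S) (by linarith)
      (fun z hz => (hcon z hz).le) k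
    -- Because $k\ge1$, one power of $1+S$ is enough: summing gives $|f(w)|(1+S)\le S|f(w)|$, which
    -- is absurd.
    have h2 : (1 + S) ≤ (1 + S) ^ k := le_self_pow₀ (by linarith) (by omega)
    rw [eval_smul, norm_smul]
    have h3 : (f.natDegree.choose k : ℝ) ≤ n.choose k := by
      exact_mod_cast Nat.choose_le_choose _ hfn
    calc _ = ‖α k‖ * (‖(derivative^[k] f).eval w‖ * (1 + S)) := by ring
      _ ≤ ‖α k‖ * (‖(derivative^[k] f).eval w‖ * (1 + S) ^ k) := by gcongr
      _ ≤ ‖α k‖ * (k ! * (f.natDegree.choose k * ‖f.eval w‖)) := by gcongr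
      _ ≤ ‖α k‖ * (k ! * (n.choose k * ‖f.eval w‖)) := by gcongr
      _ = _ := by ring
  have hdiff : (diffSum n α f).eval w - f.eval w =
      ∑ k ∈ Finset.Icc 2 n, (α k • derivative^[k] f).eval w := by
    rw [diffSum_apply, eval_add, eval_finsetSum]; ring
  rw [hdiff] at hw
  have h1 : ‖f.eval w‖ ≤ ∑ k ∈ Finset.Icc 2 n, ‖(α k • derivative^[k] f).eval w‖ := by
    rw [eq_neg_of_add_eq_zero_left hw, norm_neg, norm_mul, Complex.norm_real,
      Real.norm_of_nonneg hs.1]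
    exact (mul_le_of_le_one_left (norm_nonneg _) hs.2).trans (norm_sum_le _ _)
  have h2 := mul_le_mul_of_nonneg_right h1 (by linarith : 0 ≤ 1 + S)
  rw [Finset.sum_mul] at h2
  have h3 := h2.trans (Finset.sum_le_sum hterm)
  rw [← Finset.sum_mul, ← hS] at h3
  linarith

/-- Each point of the segment is the image of $f$ under an operator of the same form with
coefficients $s\alpha_k$. -/
theorem natDegree_segment (n : ℕ) (α : ℕ → ℂ) (f : ℂ[X]) (s : ℂ) :
    (f + C s * (diffSum n α f - f)).natDegree = f.natDegree ∧
      (f + C s * (diffSum n α f - f)).leadingCoeff = f.leadingCoeff := by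
  have h : f + C s * (diffSum n α f - f) = diffSum n (s • α) f := by
    rw [diffSum_apply, diffSum_apply, add_sub_cancel_left, Finset.mul_sum]
    congr 1
    refine Finset.sum_congr rfl fun k _ => ?_
    rw [← smul_eq_C_mul, smul_smul, Pi.smul_apply, smul_eq_mul]
  rw [h]
  have hle : (diffSum n (s • α) f).natDegree ≤ f.natDegree := by
    rw [diffSum_apply]
    refine natDegree_add_le_of_degree_le le_rfl (natDegree_sum_le_of_forall_le _ _ fun k _ => ?_)
    exact (natDegree_smul_le _ _).trans ((natDegree_iterate_derivative _ _).trans (Nat.sub_le _ _))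
  have hco := coeff_natDegree_diffSum n (s • α) f
  by_cases hf : f = 0
  · subst hf; simp
  have hd : (diffSum n (s • α) f).natDegree = f.natDegree :=
    natDegree_eq_of_le_of_coeff_ne_zero hle (by rw [hco]; exact leadingCoeff_ne_zero.2 hf)
  exact ⟨hd, by rw [leadingCoeff, hd, hco]⟩

theorem frechetDist_le {m : ℕ} {u v : Fin m → ℂ} {K : ℝ} (hK : 0 ≤ K) (σ : Equiv.Perm (Fin m))
    (h : ∀ k, ‖u k - v (σ k)‖ ≤ K) : frechetDist u v ≤ K :=
  (ciInf_le (Set.finite_range _).bddBelow σ).trans (Real.iSup_le h hK)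

theorem frechetDist_nonneg {m : ℕ} (u v : Fin m → ℂ) : 0 ≤ frechetDist u v :=
  Real.iInf_nonneg fun _ => Real.iSup_nonneg fun _ => norm_nonneg _

theorem exists_perm_frechetDist {m : ℕ} (u v : Fin m → ℂ) :
    ∃ σ : Equiv.Perm (Fin m), ∀ k, ‖u k - v (σ k)‖ ≤ frechetDist u v := by
  obtain ⟨σ, hσ⟩ := exists_eq_ciInf_of_finite
    (f := fun σ : Equiv.Perm (Fin m) => ⨆ k : Fin m, ‖u k - v (σ k)‖)
  refine ⟨σ, fun k => ?_⟩
  unfold frechetDist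
  rw [← hσ]
  exact le_ciSup (f := fun k => ‖u k - v (σ k)‖) (Set.finite_range _).bddAbove k

theorem rootDist_nonneg {n : ℕ} (T : Module.End ℂ (PolySpace n)) (f : PolySpace n) :
    0 ≤ rootDist T f := by
  apply Real.sInf_nonneg
  rintro d ⟨m, u, v, -, -, rfl⟩
  exact frechetDist_nonneg u v

theorem natDegree_le_of_polySpace {n : ℕ} (f : PolySpace n) : (f : ℂ[X]).natDegree ≤ n :=
  natDegree_le_iff_degree_le.2 (mem_degreeLE.1 f.2)

/-- The Fréchet distance of the roots of `f` and `T f` is uniformly bounded. -/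
theorem frechetBounds_nonempty (n : ℕ) (α : ℕ → ℂ) : (frechetBounds (opT n α)).Nonempty := by
  set ρ := 1 + ∑ k ∈ Finset.Icc 2 n, ‖α k‖ * ((k ! : ℝ) * n.choose k)
  have hρ : 0 ≤ ρ := add_nonneg zero_le_one (Finset.sum_nonneg fun k _ => by positivity)
  refine ⟨n * (2 * ρ) + ρ, fun f hf => ?_⟩
  have hf0 : (f : ℂ[X]) ≠ 0 := by intro h; simp [h] at hf
  have ha : (f : ℂ[X]).leadingCoeff ≠ 0 := leadingCoeff_ne_zero.2 hf0
  have hfn := natDegree_le_of_polySpace f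
  obtain ⟨z, hz⟩ := exists_eq_C_mul_prod_X_sub_C (f : ℂ[X]) rfl
  have hfroots : (f : ℂ[X]).roots = Finset.univ.val.map z := by
    conv_lhs => rw [hz]
    exact roots_C_mul_prod_X_sub_C ha z
  obtain ⟨u, hu, hzu⟩ := exists_matching_of_segment (g := diffSum n α f) ha z hρ hz
    (fun s => natDegree_segment n α f s) (fun s hs w hw => by
      obtain ⟨y, hy, hwy⟩ := exists_root_norm_sub_le_of_segment α hfn hs hw
      have hmem := (mem_roots hf0).2 hy
      rw [hfroots] at hmem
      obtain ⟨i, -, rfl⟩ := Multiset.mem_map.1 hmem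
      exact ⟨i, hwy⟩)
  have hTroots : (opT n α f : ℂ[X]).roots = Finset.univ.val.map u := by
    rw [coe_opT_eq_diffSum, hu, roots_C_mul_prod_X_sub_C ha]
  rw [rootDist, hfroots, hTroots, multisetDist_eq]
  refine frechetDist_le (by positivity) 1 fun k => (hzu k).trans ?_
  gcongr

theorem isLeast_KF {n : ℕ} (hn : n ≠ 0) (α : ℕ → ℂ) :
    IsLeast (frechetBounds (opT n α)) (KF (opT n α)) := by
  have hne := frechetBounds_nonempty n α
  have hmem : KF (opT n α) ∈ frechetBounds (opT n α) := fun f hf =>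
    le_csInf hne fun K hK => hK f hf
  -- The monomial $X^n$ witnesses that every admissible constant is nonnegative, so the infimum is a
  -- true lower bound.
  refine ⟨hmem, fun K hK => csInf_le ⟨0, fun K' hK' => ?_⟩ hK⟩
  refine (rootDist_nonneg _ (monomialTop n)).trans (hK' _ ?_)
  change 0 < (X ^ n : ℂ[X]).natDegree
  rw [natDegree_X_pow]
  exact Nat.pos_of_ne_zero hn

end RootPerturbation

/-! ### Comparison of the optimal matching with the nearby roots -/

theorem mainTheorem4 (n : ℕ) (hn : 2 ≤ n) (α : ℕ → ℂ) :
    IsLeast (RootPerturbation.frechetBounds (RootPerturbation.opT n α))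
        (RootPerturbation.KF (RootPerturbation.opT n α)) ∧
      ∀ f : RootPerturbation.PolySpace n,
        0 < (f : ℂ[X]).natDegree → (f : ℂ[X]).roots.Nodup →
          RootPerturbation.tau (f : ℂ[X]) *
              RootPerturbation.rootDist (RootPerturbation.opT n α) f ≤
            max (RootPerturbation.Gamma n α)
              (max (RootPerturbation.KF (RootPerturbation.opT n α) *
                  RootPerturbation.Gamma n α)
                (RootPerturbation.KF (RootPerturbation.opT n α) *
                  ((1 + RootPerturbation.KF (RootPerturbation.opT n α)) /
                    Real.sin (Real.pi / n)))) := by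
  have hn0 : n ≠ 0 := by omega
  have hL := RootPerturbation.isLeast_KF hn0 α
  refine ⟨hL, fun f hf hs => ?_⟩
  set T := RootPerturbation.opT n α
  set K := RootPerturbation.KF T
  set Γ := RootPerturbation.Gamma n α
  set d := RootPerturbation.rootDist T f with hd
  have hτ := RootPerturbation.tau_nonneg (f : ℂ[X])
  have hd0 : 0 ≤ d := RootPerturbation.rootDist_nonneg T f
  have hdK : d ≤ K := hL.1 f hf
  have hK0 : 0 ≤ K := hd0.trans hdK
  have hfn := RootPerturbation.natDegree_le_of_polySpace f
  have hsin : 0 < Real.sin (Real.pi / n) := by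
    have hn1 : (1 : ℝ) < n := by exact_mod_cast (by omega : 1 < n)
    exact Real.sin_pos_of_pos_of_lt_pi (by positivity) (div_lt_self Real.pi_pos hn1)
  -- A polynomial of degree 1 falls under this first case: its `tau` is the infimum of the empty
  -- set, hence $0$, in agreement with the convention that the left side is $0$.
  rcases le_or_gt (RootPerturbation.tau (f : ℂ[X])) Γ with hτΓ | hτΓ
  · refine le_max_of_le_right (le_max_of_le_left ?_)
    rw [mul_comm K]
    exact mul_le_mul hτΓ hdK hd0 (hτ.trans hτΓ)
  rcases le_or_gt (RootPerturbation.tau (f : ℂ[X])) ((1 + K) / Real.sin (Real.pi / n))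
    with hτK | hτK
  · refine le_max_of_le_right (le_max_of_le_right ?_)
    rw [mul_comm K]
    exact mul_le_mul hτK hdK hd0 (hτ.trans hτK)
  refine le_max_of_le_left ?_
  obtain ⟨u, hu⟩ := RootPerturbation.exists_map_univ_eq (f : ℂ[X]).roots rfl
  obtain ⟨v, hv⟩ := RootPerturbation.exists_map_univ_eq (T f : ℂ[X]).roots
    (RootPerturbation.card_roots_opT n α f)
  have hdF : d = RootPerturbation.frechetDist u v := by
    rw [hd, RootPerturbation.rootDist, ← RootPerturbation.multisetDist_eq, hu, hv]
  have hur : ∀ k, (f : ℂ[X]).IsRoot (u k) := fun k => isRoot_of_mem_roots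
    (hu ▸ Multiset.mem_map_of_mem u (Finset.mem_univ_val k))
  have hvr : ∀ k, (RootPerturbation.diffSum n α f).eval (v k) = 0 := fun k => by
    rw [← RootPerturbation.coe_opT_eq_diffSum]
    exact isRoot_of_mem_roots (hv ▸ Multiset.mem_map_of_mem v (Finset.mem_univ_val k))
  -- In an optimal matching $u_k$ is within $K$ of $v_{\sigma(k)}$, whose nearby root $z$ is at
  -- distance at most $\Gamma_T/\tau(f)<1$. Distinct roots of $f$ are more than $1+K$ apart, so
  -- $z=u_k$ and the matching inherits the bound $\Gamma_T/\tau(f)$.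
  obtain ⟨σ, hσ⟩ := RootPerturbation.exists_perm_frechetDist u v
  rw [← hdF] at hσ
  have hR := RootPerturbation.maxShift_nonneg T (RootPerturbation.monomialTop n)
  have hΓ : 0 ≤ Γ := le_max_of_le_left (by positivity)
  have hτ0 : 0 < RootPerturbation.tau (f : ℂ[X]) := hΓ.trans_lt hτΓ
  rw [mul_comm, ← le_div_iff₀ hτ0, hdF]
  refine RootPerturbation.frechetDist_le (by positivity) σ fun k => ?_
  obtain ⟨z, hz, hzv⟩ :=
    RootPerturbation.exists_root_tau_mul_norm_sub_le hn0 α hf hfn hs (hvr (σ k))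
  have hlt : ‖v (σ k) - z‖ < 1 := by
    by_contra! hge
    exact absurd (hzv.trans_lt hτΓ) (not_lt.2 (le_mul_of_one_le_right hτ hge))
  have hzu : z = u k := by
    by_contra hne
    have h1 := RootPerturbation.tau_mul_sin_le hn hf hfn hs hne hz (hur k)
    rw [div_lt_iff₀ hsin] at hτK
    have h2 := norm_sub_le_norm_sub_add_norm_sub (u k) (v (σ k)) z
    have h3 := hσ k
    linarith
  rw [le_div_iff₀ hτ0, mul_comm, norm_sub_rev, ← hzu]
  exact hzv
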